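/- Let $K\subset\mathbb R^2$ be a planar convex body, that is, a compact convex set with at least two points (possibly without interior points). Let $D$ be its diameter, let $r$ be its inradius (the largest radius of a closed Euclidean disc contained in $K$), and let $p$ be its perimeter (the length of its boundary; if $K$ has no interior points, twice the length of $K$). Put $\arcsin t:=\pi/2$ for $t>1$ (relevant only if $3r>D$). Then $$p\le \sqrt{4D^2-9r^2}+2D\arcsin\left(\frac{3r}{D}\right).$$ More strongly, if $3r\le D$, then $$p\le 2\sqrt{D^2-9r^2}+2D\arcsin\left(\frac{3r}{D}\right).$$ Neither bound is sharp: the first inequality is strict whenever $r>0$, and the second is strict whenever $r>0$ and $3r\le D$. -/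

import Mathlib

open MeasureTheory

noncomputable section

namespace PlanarBody

/-- The Euclidean plane. -/
abbrev Plane : Type := EuclideanSpace ℝ (Fin 2)

/-- The diameter of a convex body: the largest Euclidean distance between two of its points. -/
def diameter (K : ConvexBody Plane) : ℝ :=
  Metric.diam (K : Set Plane)

/-- The inradius of a convex body: the largest radius of a closed Euclidean disc contained in it.
Discs of radius zero (single points) are allowed, so bodies without interior have inradius zero. -/
def inradius (K : ConvexBody Plane) : ℝ :=
  sSup {ρ : ℝ | 0 ≤ ρ ∧ ∃ x : Plane, Metric.closedBall x ρ ⊆ (K : Set Plane)}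

open Classical in
/-- The perimeter of a convex body: the length (one-dimensional Hausdorff measure) of its boundary.
A body without interior is a point or a segment; as usual in convex geometry, a segment is
regarded as a degenerate polygon with two edges, so its length counts twice. -/
def perimeter (K : ConvexBody Plane) : ENNReal :=
  if (interior (K : Set Plane)).Nonempty then
    Measure.hausdorffMeasure 1 (frontier (K : Set Plane))
  else
    2 * Measure.hausdorffMeasure 1 (K : Set Plane)

end PlanarBody

end

/-! The perimeter is at most the integral of the width over a half-turn, the upper half of Cauchy's
formula (`hausdorffMeasure_frontier_le`). Helly's theorem gives a point `c` whose distance to each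
supporting line is at least a third of the width in that direction, so some width is at most `3r`
(`exists_width_le`). All differences of points of `K` then lie in a disc of radius `D` cut by a
strip of half-width `3r`. Integrating the support function of this cut disc, with `sin β = 3r / D`,
gives the stronger bound (`integral_width_le`). The weaker bound follows from it when `3r ≤ D`. When
`3r > D`, the bound `πD` suffices, the square root being positive because `2r ≤ D`.

For strictness, equality would make the widths equal to the support function of the cut disc. If `3r
< D`, the width `3r` is then attained in one direction modulo `π` only, so the disc of radius `r`
about `c` touches the boundary on one side at most and can be moved and enlarged. If `3r = D`, `K`
has constant width, and a weak form of Jung's theorem gives `r > D / 3`. -/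

noncomputable section

namespace PlanarBody

open Set Real

open scoped Pointwise

/-! ### Coordinates, support function, width and inradius. -/

section

/-- The coordinate of `x` along the unit vector at angle `θ`. -/
def coord (θ : ℝ) (x : Plane) : ℝ := x 0 * cos θ + x 1 * sin θ

lemma coord_add (θ : ℝ) (x y : Plane) : coord θ (x + y) = coord θ x + coord θ y := by
  simp [coord]; ring

lemma coord_sub (θ : ℝ) (x y : Plane) : coord θ (x - y) = coord θ x - coord θ y := by
  simp [coord]; ring

lemma coord_smul (θ t : ℝ) (x : Plane) : coord θ (t • x) = t * coord θ x := by
  simp [coord]; ring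

lemma coord_add_pi (θ : ℝ) (x : Plane) : coord (θ + π) x = -coord θ x := by
  simp [coord]; ring

lemma coord_add_two_pi (θ : ℝ) (x : Plane) : coord (θ + 2 * π) x = coord θ x := by
  simp [coord]

lemma coord_angle_add (θ ψ : ℝ) (x : Plane) :
    coord (θ + ψ) x = cos ψ * coord θ x + sin ψ * coord (θ + π / 2) x := by
  simp only [coord, cos_add, sin_add, cos_pi_div_two, sin_pi_div_two]; ring

lemma coord_angle_sub (θ ψ : ℝ) (x : Plane) :
    coord (θ - ψ) x = cos ψ * coord θ x - sin ψ * coord (θ + π / 2) x := by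
  simp only [coord, cos_add, sin_add, cos_sub, sin_sub, cos_pi_div_two, sin_pi_div_two]; ring

lemma norm_sq_eq_coord (θ : ℝ) (x : Plane) :
    ‖x‖ ^ 2 = coord θ x ^ 2 + coord (θ + π / 2) x ^ 2 := by
  rw [EuclideanSpace.norm_sq_eq, Fin.sum_univ_two]
  simp only [coord, cos_add, sin_add, cos_pi_div_two, sin_pi_div_two, norm_eq_abs, sq_abs]
  linear_combination (-(x 0) ^ 2 - (x 1) ^ 2) * sin_sq_add_cos_sq θ

lemma abs_coord_le_norm (θ : ℝ) (x : Plane) : |coord θ x| ≤ ‖x‖ := by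
  apply abs_le_of_sq_le_sq _ (norm_nonneg x)
  rw [norm_sq_eq_coord θ x]
  nlinarith [sq_nonneg (coord (θ + π / 2) x)]

lemma coord_le_norm (θ : ℝ) (x : Plane) : coord θ x ≤ ‖x‖ :=
  (le_abs_self _).trans (abs_coord_le_norm θ x)

lemma continuous_coord (θ : ℝ) : Continuous (coord θ) := by
  unfold coord; fun_prop

lemma continuous_coord_angle (x : Plane) : Continuous fun θ => coord θ x := by
  unfold coord; fun_prop

lemma ext_coord {θ : ℝ} {x y : Plane} (h₀ : coord θ x = coord θ y)
    (h₁ : coord (θ + π / 2) x = coord (θ + π / 2) y) : x = y := by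
  have h : ‖x - y‖ ^ 2 = 0 := by
    rw [norm_sq_eq_coord θ, coord_sub, coord_sub, h₀, h₁]; ring
  exact sub_eq_zero.1 (norm_eq_zero.1 (pow_eq_zero_iff (two_ne_zero)|>.1 h))

lemma abs_coord_sub_coord_le (θ φ : ℝ) (x : Plane) :
    |coord θ x - coord φ x| ≤ 2 * ‖x‖ * |θ - φ| := by
  have hc : |cos θ - cos φ| ≤ |θ - φ| := by
    have := Real.abs_cos_sub_cos_le θ φ
    simpa using this
  have hs : |sin θ - sin φ| ≤ |θ - φ| := by
    have := Real.abs_sin_sub_sin_le θ φ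
    simpa using this
  have h0 : |x 0| ≤ ‖x‖ := by simpa using PiLp.norm_apply_le x 0
  have h1 : |x 1| ≤ ‖x‖ := by simpa using PiLp.norm_apply_le x 1
  calc |coord θ x - coord φ x| = |x 0 * (cos θ - cos φ) + x 1 * (sin θ - sin φ)| := by
        unfold coord; ring_nf
    _ ≤ |x 0| * |cos θ - cos φ| + |x 1| * |sin θ - sin φ| := by
        rw [← abs_mul, ← abs_mul]; exact abs_add_le _ _
    _ ≤ ‖x‖ * |θ - φ| + ‖x‖ * |θ - φ| := by gcongr
    _ = _ := by ring

/-- Every nonzero functional on the plane is a positive multiple of a coordinate. -/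
lemma exists_eq_mul_coord (f : StrongDual ℝ Plane) (hf : f ≠ 0) :
    ∃ t > 0, ∃ θ, ∀ x, f x = t * coord θ x := by
  set a := f (EuclideanSpace.single 0 1) with ha
  set b := f (EuclideanSpace.single 1 1) with hb
  have hfx : ∀ x : Plane, f x = x 0 * a + x 1 * b := by
    intro x
    have : x = x 0 • EuclideanSpace.single 0 1 + x 1 • EuclideanSpace.single 1 1 := by
      ext i; fin_cases i <;> simp
    conv_lhs => rw [this]
    rw [map_add, map_smul, map_smul, smul_eq_mul, smul_eq_mul]
  set z : ℂ := ⟨a, b⟩ with hz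
  have hz0 : z ≠ 0 := by
    intro h
    have h1 : a = 0 := congrArg Complex.re h
    have h2 : b = 0 := congrArg Complex.im h
    apply hf; ext x; rw [hfx, h1, h2]; simp
  refine ⟨‖z‖, norm_pos_iff.2 hz0, Complex.arg z, fun x => ?_⟩
  have h1 : ‖z‖ * cos (Complex.arg z) = a := Complex.norm_mul_cos_arg z
  have h2 : ‖z‖ * sin (Complex.arg z) = b := Complex.norm_mul_sin_arg z
  rw [hfx, coord, ← h1, ← h2]; ring

lemma exists_coord_lt_of_notMem {K : ConvexBody Plane} {y : Plane} (hy : y ∉ K) :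
    ∃ θ, ∀ x ∈ K, coord θ x < coord θ y := by
  obtain ⟨f, u, h1, h2⟩ := geometric_hahn_banach_closed_point K.convex K.isClosed hy
  obtain ⟨x₀, hx₀⟩ := K.nonempty
  have hf : f ≠ 0 := by
    rintro rfl
    have := h1 x₀ hx₀
    simp at this h2; linarith
  obtain ⟨t, ht, θ, h⟩ := exists_eq_mul_coord f hf
  refine ⟨θ, fun x hx => ?_⟩
  have := (h1 x hx).trans h2
  rw [h, h] at this
  exact lt_of_mul_lt_mul_left this ht.le

lemma exists_coord_le_of_mem_frontier {K : ConvexBody Plane}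
    (hK : (interior (K : Set Plane)).Nonempty) {y : Plane} (hy : y ∈ frontier (K : Set Plane)) :
    ∃ θ, ∀ x ∈ K, coord θ x ≤ coord θ y := by
  obtain ⟨f, hf, h1⟩ := geometric_hahn_banach_of_nonempty_interior_point K.convex hy.2 hK
  obtain ⟨t, ht, θ, h⟩ := exists_eq_mul_coord f hf
  refine ⟨θ, fun x hx => ?_⟩
  have := h1 x hx
  rw [h, h] at this
  exact le_of_mul_le_mul_left this ht

/-- In direction `θ` there is an extreme point of `K`, the last one counterclockwise. -/
lemma exists_suppPt (K : ConvexBody Plane) (θ : ℝ) :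
    ∃ x ∈ K, ∀ y ∈ K, coord θ y ≤ coord θ x ∧
      (coord θ y = coord θ x → coord (θ + π / 2) y ≤ coord (θ + π / 2) x) := by
  obtain ⟨x₀, hx₀, hmax⟩ :=
    K.isCompact.exists_isMaxOn K.nonempty (continuous_coord θ).continuousOn
  have hc : IsCompact ((K : Set Plane) ∩ {x | coord θ x = coord θ x₀}) :=
    K.isCompact.inter_right (isClosed_eq (continuous_coord θ) continuous_const)
  obtain ⟨x, hx, hmax'⟩ :=
    hc.exists_isMaxOn ⟨x₀, hx₀, rfl⟩ (continuous_coord (θ + π / 2)).continuousOn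
  have hxe : coord θ x = coord θ x₀ := hx.2
  refine ⟨x, hx.1, fun y hy => ⟨?_, fun h => ?_⟩⟩
  · rw [hxe]; exact hmax hy
  · exact hmax' ⟨hy, h.trans hxe⟩

/-- The extreme point of `K` in direction `θ`, the last one counterclockwise. -/
def suppPt (K : ConvexBody Plane) (θ : ℝ) : Plane := (exists_suppPt K θ).choose

/-- The support function of `K`. -/
def supp (K : ConvexBody Plane) (θ : ℝ) : ℝ := coord θ (suppPt K θ)

/-- The width of `K` in direction `θ`. -/
def width (K : ConvexBody Plane) (θ : ℝ) : ℝ := supp K θ + supp K (θ + π)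

variable (K : ConvexBody Plane)

lemma suppPt_mem (θ : ℝ) : suppPt K θ ∈ K := (exists_suppPt K θ).choose_spec.1

variable {K} in
lemma coord_le_supp (θ : ℝ) {x : Plane} (hx : x ∈ K) : coord θ x ≤ supp K θ :=
  ((exists_suppPt K θ).choose_spec.2 x hx).1

variable {K} in
lemma coord_tangent_le (θ : ℝ) {x : Plane} (hx : x ∈ K) (h : coord θ x = supp K θ) :
    coord (θ + π / 2) x ≤ coord (θ + π / 2) (suppPt K θ) :=
  ((exists_suppPt K θ).choose_spec.2 x hx).2 h

/-- The tie-break makes the extreme point unique, so the choice made at each angle is periodic. -/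
lemma suppPt_add_two_pi (θ : ℝ) : suppPt K (θ + 2 * π) = suppPt K θ := by
  have h : supp K (θ + 2 * π) = supp K θ := by
    apply le_antisymm
    · rw [supp, coord_add_two_pi]; exact coord_le_supp θ (suppPt_mem K _)
    · rw [supp, ← coord_add_two_pi]; exact coord_le_supp _ (suppPt_mem K _)
  have h0 : coord θ (suppPt K (θ + 2 * π)) = supp K θ := by
    rw [← coord_add_two_pi]; exact h
  apply ext_coord h0
  apply le_antisymm
  · exact coord_tangent_le θ (suppPt_mem K _) h0
  · rw [← coord_add_two_pi, ← coord_add_two_pi (θ + π / 2),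
      show θ + π / 2 + 2 * π = θ + 2 * π + π / 2 by ring]
    apply coord_tangent_le _ (suppPt_mem K _)
    rw [coord_add_two_pi, h]; rfl

lemma supp_add_two_pi (θ : ℝ) : supp K (θ + 2 * π) = supp K θ := by
  rw [supp, suppPt_add_two_pi, coord_add_two_pi, supp]

lemma width_add_pi (θ : ℝ) : width K (θ + π) = width K θ := by
  rw [width, width, add_assoc, ← two_mul, supp_add_two_pi, add_comm]

lemma exists_norm_le : ∃ R : ℝ, 0 ≤ R ∧ ∀ x ∈ K, ‖x‖ ≤ R := by
  obtain ⟨R, hR⟩ := K.isBounded.exists_norm_le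
  obtain ⟨x, hx⟩ := K.nonempty
  exact ⟨R, (norm_nonneg x).trans (hR x hx), hR⟩

lemma continuous_supp : Continuous (supp K) := by
  obtain ⟨R, hR0, hR⟩ := exists_norm_le K
  refine (LipschitzWith.of_le_add_mul (Real.toNNReal (2 * R)) fun θ φ => ?_).continuous
  rw [Real.coe_toNNReal _ (by positivity), Real.dist_eq]
  have h1 := (le_abs_self _).trans (abs_coord_sub_coord_le θ φ (suppPt K θ))
  have h2 := coord_le_supp φ (suppPt_mem K θ)
  have h3 : 2 * ‖suppPt K θ‖ * |θ - φ| ≤ 2 * R * |θ - φ| := by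
    gcongr; exact hR _ (suppPt_mem K θ)
  rw [show supp K θ = coord θ (suppPt K θ) from rfl]
  linarith

lemma continuous_width : Continuous (width K) :=
  (continuous_supp K).add ((continuous_supp K).comp (continuous_id.add continuous_const))

lemma width_eq (θ : ℝ) : width K θ = coord θ (suppPt K θ - suppPt K (θ + π)) := by
  rw [width, supp, supp, coord_add_pi, coord_sub]; ring

variable {K} in
lemma norm_sub_le_diameter {x y : Plane} (hx : x ∈ K) (hy : y ∈ K) : ‖x - y‖ ≤ diameter K := by
  rw [← dist_eq_norm]; exact Metric.dist_le_diam_of_mem K.isBounded hx hy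

lemma width_le_diameter (θ : ℝ) : width K θ ≤ diameter K := by
  rw [width_eq]
  exact (coord_le_norm _ _).trans (norm_sub_le_diameter (suppPt_mem K _) (suppPt_mem K _))

variable {K} in
lemma coord_sub_le_width (θ : ℝ) {x y : Plane} (hx : x ∈ K) (hy : y ∈ K) :
    coord θ (x - y) ≤ width K θ := by
  have h1 := coord_le_supp θ hx
  have h2 := coord_le_supp (θ + π) hy
  rw [coord_add_pi] at h2
  rw [coord_sub, width]; linarith

variable {K} in
lemma abs_coord_sub_le_width (θ : ℝ) {x y : Plane} (hx : x ∈ K) (hy : y ∈ K) :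
    |coord θ (x - y)| ≤ width K θ := by
  rw [abs_le']
  refine ⟨coord_sub_le_width θ hx hy, ?_⟩
  have := coord_sub_le_width θ hy hx
  rw [coord_sub] at this ⊢; linarith

variable {K} in
lemma closedBall_subset {c : Plane} {ρ : ℝ} (h : ∀ θ, coord θ c + ρ ≤ supp K θ) :
    Metric.closedBall c ρ ⊆ (K : Set Plane) := by
  intro y hy
  by_contra hyK
  obtain ⟨θ, hθ⟩ := exists_coord_lt_of_notMem hyK
  have h1 : coord θ (suppPt K θ) < coord θ y := hθ _ (suppPt_mem K θ)
  have h2 := coord_le_norm θ (y - c)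
  rw [coord_sub] at h2
  have h3 : ‖y - c‖ ≤ ρ := by rwa [← dist_eq_norm]
  have h4 : coord θ c + ρ ≤ coord θ (suppPt K θ) := h θ
  linarith

lemma exists_mem_closedBall_coord_eq (θ : ℝ) (c : Plane) {ρ : ℝ} (hρ : 0 ≤ ρ) :
    ∃ y ∈ Metric.closedBall c ρ, coord θ y = coord θ c + ρ := by
  refine ⟨c + !₂[ρ * cos θ, ρ * sin θ], ?_, ?_⟩
  · rw [Metric.mem_closedBall, dist_eq_norm, add_sub_cancel_left]
    apply le_of_sq_le_sq _ hρ
    rw [EuclideanSpace.norm_sq_eq, Fin.sum_univ_two]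
    simp only [norm_eq_abs, sq_abs, Matrix.cons_val_zero, Matrix.cons_val_one]
    exact le_of_eq (by linear_combination ρ ^ 2 * sin_sq_add_cos_sq θ)
  · rw [coord_add]
    simp [coord]
    linear_combination ρ * sin_sq_add_cos_sq θ

variable {K} in
lemma coord_add_le_supp {c : Plane} {ρ : ℝ} (hρ : 0 ≤ ρ)
    (h : Metric.closedBall c ρ ⊆ (K : Set Plane)) (θ : ℝ) : coord θ c + ρ ≤ supp K θ := by
  obtain ⟨y, hy, hc⟩ := exists_mem_closedBall_coord_eq θ c hρ
  rw [← hc]; exact coord_le_supp θ (h hy)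

variable {K} in
lemma le_inradius {c : Plane} {ρ : ℝ} (hρ : 0 ≤ ρ)
    (h : Metric.closedBall c ρ ⊆ (K : Set Plane)) : ρ ≤ inradius K := by
  refine le_csSup ⟨diameter K, ?_⟩ ⟨hρ, c, h⟩
  rintro σ ⟨hσ, x, hx⟩
  have h1 := coord_add_le_supp hσ hx 0
  have h2 := coord_add_le_supp hσ hx (0 + π)
  have h3 := width_le_diameter K 0
  rw [coord_add_pi] at h2
  rw [width] at h3
  linarith

lemma inradius_nonneg : 0 ≤ inradius K :=
  Real.sSup_nonneg fun _ h => h.1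

end

/-! ### Length of boundary arcs via their projection to a tangent direction. -/

section

/-- A displacement between points with outer normals at `α < γ` runs counterclockwise. -/
lemma cos_mul_norm_le_coord_of_lt {θ δ α γ : ℝ} {v : Plane} (hδ : δ < π / 2) (hα : θ ≤ α)
    (hαγ : α < γ) (hγ : γ ≤ θ + δ) (hv : coord α v ≤ 0) (hv' : 0 ≤ coord γ v) :
    cos δ * ‖v‖ ≤ coord (θ + π / 2) v := by
  have hs : 0 < sin (γ - α) := sin_pos_of_pos_of_lt_pi (by linarith) (by linarith [pi_pos])
  have hc1 : cos δ ≤ cos (γ - θ) :=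
    cos_le_cos_of_nonneg_of_le_pi (by linarith) (by linarith [pi_pos]) (by linarith)
  have hc2 : cos δ ≤ cos (α - θ) :=
    cos_le_cos_of_nonneg_of_le_pi (by linarith) (by linarith [pi_pos]) (by linarith)
  have hc : 0 ≤ cos δ := cos_nonneg_of_mem_Icc ⟨by linarith [pi_pos], hδ.le⟩
  have hγv : coord γ v = cos (γ - α) * coord α v + sin (γ - α) * coord (α + π / 2) v := by
    rw [← coord_angle_add]; ring_nf
  -- `sin (γ - α) • v` is the combination of the unit vectors at angles `α + π / 2` and `γ + π / 2`
  -- with coefficients `coord γ v` and `-coord α v`, both nonnegative. `hT` is its component at `θ +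
  -- π / 2`, and `hn` its triangle inequality.
  have hT : sin (γ - α) * coord (θ + π / 2) v =
      cos (γ - θ) * (-coord α v) + cos (α - θ) * coord γ v := by
    simp only [coord, cos_add, sin_add, cos_sub, sin_sub, cos_pi_div_two, sin_pi_div_two]
    ring
  have hn : sin (γ - α) * ‖v‖ ≤ coord γ v - coord α v := by
    apply le_of_sq_le_sq _ (by linarith)
    rw [mul_pow, norm_sq_eq_coord α]
    have h1 : sin (γ - α) * coord (α + π / 2) v = coord γ v - cos (γ - α) * coord α v := by
      linarith
    have h2 : 0 ≤ -(coord α v * coord γ v) * (1 - cos (γ - α)) := by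
      apply mul_nonneg
      · nlinarith
      · linarith [cos_le_one (γ - α)]
    have h3 : sin (γ - α) ^ 2 * (coord α v ^ 2 + coord (α + π / 2) v ^ 2) =
        coord α v ^ 2 + coord γ v ^ 2 - 2 * coord α v * coord γ v * cos (γ - α) := by
      rw [mul_add, ← mul_pow _ (coord (α + π / 2) v), h1, sin_sq]; ring
    rw [h3]; nlinarith
  refine le_of_mul_le_mul_left ?_ hs
  calc sin (γ - α) * (cos δ * ‖v‖) = cos δ * (sin (γ - α) * ‖v‖) := by ring
    _ ≤ cos δ * (coord γ v - coord α v) := by gcongr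
    _ = cos δ * (-coord α v) + cos δ * coord γ v := by ring
    _ ≤ cos (γ - θ) * (-coord α v) + cos (α - θ) * coord γ v := by
        gcongr; linarith
    _ = _ := hT.symm

/-- When `α = γ` the displacement runs along a common supporting line with either orientation, hence
the absolute value. -/
lemma cos_mul_norm_le_abs_coord {θ δ α γ : ℝ} {v : Plane} (hδ : δ < π / 2) (hα : θ ≤ α)
    (hαγ : α ≤ γ) (hγ : γ ≤ θ + δ) (hv : coord α v ≤ 0) (hv' : 0 ≤ coord γ v) :
    cos δ * ‖v‖ ≤ |coord (θ + π / 2) v| := by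
  rcases hαγ.lt_or_eq with h | rfl
  · exact (cos_mul_norm_le_coord_of_lt hδ hα h hγ hv hv').trans (le_abs_self _)
  have h0 : coord α v = 0 := le_antisymm hv hv'
  have hc2 : cos δ ≤ cos (α - θ) :=
    cos_le_cos_of_nonneg_of_le_pi (by linarith) (by linarith [pi_pos]) (by linarith)
  have hc : 0 ≤ cos δ := cos_nonneg_of_mem_Icc ⟨by linarith [pi_pos], hδ.le⟩
  have hn : ‖v‖ = |coord (α + π / 2) v| := by
    rw [← abs_of_nonneg (norm_nonneg v), ← sq_eq_sq_iff_abs_eq_abs, norm_sq_eq_coord α, h0]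
    ring
  have hT : coord (θ + π / 2) v = cos (α - θ) * coord (α + π / 2) v := by
    rw [show θ + π / 2 = α + (π / 2 - (α - θ)) by ring, coord_angle_add, h0,
      sin_pi_div_two_sub]; ring
  rw [hT, abs_mul, hn, abs_of_nonneg (hc.trans hc2)]
  gcongr

/-- The coordinate shrinks distances in `S` by a factor no smaller than `c`, so `S` is at most `1 /
c` times as long as its image. -/
lemma hausdorffMeasure_le_of_coord {S : Set Plane} {c τ a b : ℝ} (hc : 0 < c)
    (h : ∀ x ∈ S, ∀ y ∈ S, c * ‖x - y‖ ≤ |coord τ (x - y)|)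
    (hab : ∀ x ∈ S, coord τ x ∈ Icc a b) :
    μH[1] S ≤ ENNReal.ofReal ((b - a) / c) := by
  have hanti : AntilipschitzWith (Real.toNNReal (1 / c)) fun x : S => coord τ x := by
    apply AntilipschitzWith.of_le_mul_dist
    intro x y
    rw [Real.coe_toNNReal _ (by positivity), Subtype.dist_eq, dist_eq_norm, Real.dist_eq,
      ← coord_sub, div_mul_eq_mul_div, one_mul, le_div_iff₀ hc, mul_comm]
    exact h x x.2 y y.2
  have h1 := hanti.le_hausdorffMeasure_image (d := 1) zero_le_one univ
  rw [← isometry_subtype_coe.hausdorffMeasure_image (Or.inl zero_le_one) univ, image_univ,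
    Subtype.range_coe, hausdorffMeasure_real, ENNReal.rpow_one] at h1
  refine h1.trans ?_
  have h2 : volume ((fun x : S => coord τ x) '' univ) ≤ ENNReal.ofReal (b - a) := by
    rw [← Real.volume_Icc]
    apply measure_mono
    rintro _ ⟨x, -, rfl⟩
    exact hab x x.2
  calc _ ≤ ENNReal.ofReal (1 / c) * ENNReal.ofReal (b - a) := by
        gcongr; rfl
    _ = _ := by
        rw [← ENNReal.ofReal_mul (by positivity)]; congr 1; ring

/-- The points of `K` that have an outer normal with angle in `(θ, θ + δ]`. -/
def arc (K : ConvexBody Plane) (θ δ : ℝ) : Set Plane :=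
  {x | x ∈ K ∧ ∃ α ∈ Ioc θ (θ + δ), ∀ y ∈ K, coord α y ≤ coord α x}

variable (K : ConvexBody Plane)

/-- Directions along the arc deviate from `θ + π / 2` by at most `δ`, so projection loses at most
the factor `cos δ`. The projection lies between those of the two extreme points. -/
lemma hausdorffMeasure_arc_le {δ : ℝ} (hδ0 : 0 < δ) (hδ : δ < π / 2) (θ : ℝ) :
    μH[1] (arc K θ δ) ≤ ENNReal.ofReal ((coord (θ + π / 2) (suppPt K (θ + δ)) -
      coord (θ + π / 2) (suppPt K θ)) / cos δ) := by
  have hc : 0 < cos δ := cos_pos_of_mem_Ioo ⟨by linarith [pi_pos], hδ⟩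
  apply hausdorffMeasure_le_of_coord (τ := θ + π / 2) hc
  · rintro x ⟨hx, α, hα, hxα⟩ y ⟨hy, γ, hγ, hyγ⟩
    rcases le_total α γ with h | h
    · rw [norm_sub_rev, coord_sub, abs_sub_comm, ← coord_sub]
      refine cos_mul_norm_le_abs_coord hδ hα.1.le h hγ.2 ?_ ?_ <;> rw [coord_sub]
      · linarith [hxα y hy]
      · linarith [hyγ x hx]
    · refine cos_mul_norm_le_abs_coord hδ hγ.1.le h hα.2 ?_ ?_ <;> rw [coord_sub]
      · linarith [hyγ x hx]
      · linarith [hxα y hy]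
  · rintro x ⟨hx, α, hα, hxα⟩
    constructor
    · have h := cos_mul_norm_le_coord_of_lt (v := x - suppPt K θ) hδ le_rfl hα.1 hα.2
        (by rw [coord_sub]; have := coord_le_supp θ hx; rw [supp] at this; linarith)
        (by rw [coord_sub]; linarith [hxα _ (suppPt_mem K θ)])
      rw [coord_sub] at h
      have := mul_nonneg hc.le (norm_nonneg (x - suppPt K θ))
      linarith
    · rcases hα.2.lt_or_eq with h | rfl
      · have h := cos_mul_norm_le_coord_of_lt (v := suppPt K (θ + δ) - x) hδ hα.1.le h le_rfl
          (by rw [coord_sub]; linarith [hxα _ (suppPt_mem K (θ + δ))])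
          (by rw [coord_sub]; have := coord_le_supp (θ + δ) hx; rw [supp] at this; linarith)
        rw [coord_sub] at h
        have := mul_nonneg hc.le (norm_nonneg (suppPt K (θ + δ) - x))
        linarith
      -- At the included end of the normal interval `x` may lie on an edge. The tie-break in
      -- `suppPt` places it before the extreme point.
      · have h0 : coord (θ + δ) x = supp K (θ + δ) :=
          le_antisymm (coord_le_supp _ hx) (hxα _ (suppPt_mem K _))
        have h1 := coord_tangent_le (θ + δ) hx h0
        have h2 : ∀ z : Plane, coord (θ + π / 2) z =
            sin δ * coord (θ + δ) z + cos δ * coord (θ + δ + π / 2) z := by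
          intro z
          rw [show θ + π / 2 = θ + δ + (π / 2 - δ) by ring, coord_angle_add,
            cos_pi_div_two_sub, sin_pi_div_two_sub]
        rw [h2, h2, h0, supp]
        gcongr

lemma frontier_subset_iUnion_arc (hK : (interior (K : Set Plane)).Nonempty) {N : ℕ} {δ : ℝ}
    (hδ0 : 0 < δ) (hN : N * δ = 2 * π) (s : ℝ) :
    frontier (K : Set Plane) ⊆ ⋃ i ∈ Finset.range N, arc K (s + i * δ) δ := by
  intro x hx
  obtain ⟨θ, hθ⟩ := exists_coord_le_of_mem_frontier hK hx
  have hxK : x ∈ K := K.isClosed.frontier_subset hx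
  set φ := toIocMod two_pi_pos s θ with hφ
  have hmem : φ ∈ Ioc s (s + 2 * π) := toIocMod_mem_Ioc two_pi_pos s θ
  have hco : ∀ y, coord φ y = coord θ y := by
    intro y
    have : φ = θ - toIocDiv two_pi_pos s θ * (2 * π) := by
      rw [hφ, toIocMod, zsmul_eq_mul]
    rw [this, coord, coord, cos_sub_int_mul_two_pi, sin_sub_int_mul_two_pi]
  -- The normal intervals are open on the left and closed on the right, so the index is the ceiling
  -- minus one.
  set n := ⌈(φ - s) / δ⌉₊ with hn
  have hpos : 0 < (φ - s) / δ := div_pos (by linarith [hmem.1]) hδ0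
  have hn1 : 0 < n := Nat.ceil_pos.2 hpos
  have hnN : n ≤ N := by
    apply Nat.ceil_le.2
    rw [div_le_iff₀ hδ0, hN]; linarith [hmem.2]
  have h1 : φ - s ≤ n * δ := by
    rw [← div_le_iff₀ hδ0]; exact Nat.le_ceil _
  have h2 : (n : ℝ) * δ < φ - s + δ := by
    have := Nat.ceil_lt_add_one hpos.le
    rw [← hn] at this
    calc (n : ℝ) * δ < ((φ - s) / δ + 1) * δ := by gcongr
      _ = _ := by field_simp
  have hcast : ((n - 1 : ℕ) : ℝ) = n - 1 := by
    rw [Nat.cast_sub hn1, Nat.cast_one]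
  refine mem_iUnion₂.2 ⟨n - 1, Finset.mem_range.2 (by omega), hxK, φ, ⟨?_, ?_⟩, fun y hy => ?_⟩
  · rw [hcast]; linarith
  · rw [hcast]; linarith
  · rw [hco, hco]; exact hθ y hy

lemma sum_range_eq_sum_range_succ {M : Type*} [AddCommGroup M] (f : ℕ → M) {N : ℕ}
    (h : f N = f 0) : ∑ i ∈ Finset.range N, f i = ∑ i ∈ Finset.range N, f (i + 1) := by
  have h1 := Finset.sum_range_succ f N
  have h2 := Finset.sum_range_succ' f N
  rw [h1, h] at h2
  exact add_right_cancel h2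

/-- After a cyclic shift each extreme point is paired with the two tangent directions at `φ - δ` and
`φ`. Their difference contributes `sin δ * supp K φ` and an error of second order in `δ`. -/
lemma sum_arc_le {N : ℕ} {δ : ℝ} (hN : N * δ = 2 * π) {R : ℝ} (hR : ∀ x ∈ K, ‖x‖ ≤ R) (s : ℝ) :
    ∑ i ∈ Finset.range N, (coord (s + i * δ + π / 2) (suppPt K (s + i * δ + δ)) -
      coord (s + i * δ + π / 2) (suppPt K (s + i * δ))) ≤
    sin δ * ∑ i ∈ Finset.range N, supp K (s + i * δ) + N * ((1 - cos δ) * R) := by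
  have hper : coord (s + N * δ + π / 2) (suppPt K (s + N * δ)) =
      coord (s + (0 : ℕ) * δ + π / 2) (suppPt K (s + (0 : ℕ) * δ)) := by
    rw [hN, suppPt_add_two_pi, add_right_comm, coord_add_two_pi]; simp
  have hper' : supp K (s + N * δ) = supp K (s + (0 : ℕ) * δ) := by
    rw [hN, supp_add_two_pi]; simp
  rw [Finset.sum_sub_distrib,
    sum_range_eq_sum_range_succ (fun i => coord (s + i * δ + π / 2) (suppPt K (s + i * δ))) hper,
    sum_range_eq_sum_range_succ (fun i => supp K (s + i * δ)) hper', ← Finset.sum_sub_distrib,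
    Finset.mul_sum]
  have hconst : (N : ℝ) * ((1 - cos δ) * R) = ∑ i ∈ Finset.range N, (1 - cos δ) * R := by simp
  rw [hconst, ← Finset.sum_add_distrib]
  apply Finset.sum_le_sum
  intro i _
  have he : s + ((i + 1 : ℕ) : ℝ) * δ = s + i * δ + δ := by push_cast; ring
  rw [he]
  set φ := s + i * δ + δ with hφ
  have h1 : coord (s + i * δ + π / 2) (suppPt K φ) =
      sin δ * supp K φ + cos δ * coord (φ + π / 2) (suppPt K φ) := by
    rw [show s + i * δ + π / 2 = φ + (π / 2 - δ) by rw [hφ]; ring, coord_angle_add,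
      cos_pi_div_two_sub, sin_pi_div_two_sub, supp]
  have h2 : -coord (φ + π / 2) (suppPt K φ) ≤ R :=
    (neg_le_abs _).trans ((abs_coord_le_norm _ _).trans (hR _ (suppPt_mem K φ)))
  have h3 : (1 - cos δ) * (-coord (φ + π / 2) (suppPt K φ)) ≤ (1 - cos δ) * R := by
    gcongr
    linarith [cos_le_one δ]
  rw [h1]; linarith

end

/-! ### Cauchy's formula: perimeter at most the integral of the width. -/

section

variable (K : ConvexBody Plane)

lemma coord_tangent_suppPt_le {δ : ℝ} (hδ0 : 0 < δ) (hδ : δ < π / 2) (φ : ℝ) :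
    coord (φ + π / 2) (suppPt K φ) ≤ coord (φ + π / 2) (suppPt K (φ + δ)) := by
  have hc : 0 ≤ cos δ := cos_nonneg_of_mem_Icc ⟨by linarith [pi_pos], hδ.le⟩
  have h := cos_mul_norm_le_coord_of_lt (θ := φ) (α := φ) (γ := φ + δ)
    (v := suppPt K (φ + δ) - suppPt K φ) hδ le_rfl (by linarith) le_rfl
    (by rw [coord_sub]; exact sub_nonpos.2 (coord_le_supp φ (suppPt_mem K (φ + δ))))
    (by rw [coord_sub]; exact sub_nonneg.2 (coord_le_supp (φ + δ) (suppPt_mem K φ)))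
  rw [coord_sub] at h
  exact sub_nonneg.1 ((mul_nonneg hc (norm_nonneg _)).trans h)

lemma hausdorffMeasure_frontier_le_sum (hK : (interior (K : Set Plane)).Nonempty) {N : ℕ} {δ : ℝ}
    (hδ0 : 0 < δ) (hδ : δ < π / 2) (hN : N * δ = 2 * π) {R : ℝ} (hR : ∀ x ∈ K, ‖x‖ ≤ R) (s : ℝ) :
    μH[1] (frontier (K : Set Plane)) ≤ ENNReal.ofReal
      ((sin δ * ∑ i ∈ Finset.range N, supp K (s + i * δ) + N * ((1 - cos δ) * R)) / cos δ) := by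
  have hc : 0 < cos δ := cos_pos_of_mem_Ioo ⟨by linarith [pi_pos], hδ⟩
  calc μH[1] (frontier (K : Set Plane))
      ≤ μH[1] (⋃ i ∈ Finset.range N, arc K (s + i * δ) δ) :=
        measure_mono (frontier_subset_iUnion_arc K hK hδ0 hN s)
    _ ≤ ∑ i ∈ Finset.range N, μH[1] (arc K (s + i * δ) δ) := measure_biUnion_finset_le _ _
    _ ≤ ∑ i ∈ Finset.range N, ENNReal.ofReal
          ((coord (s + i * δ + π / 2) (suppPt K (s + i * δ + δ)) -
            coord (s + i * δ + π / 2) (suppPt K (s + i * δ))) / cos δ) :=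
        Finset.sum_le_sum fun i _ => hausdorffMeasure_arc_le K hδ0 hδ _
    _ = ENNReal.ofReal ((∑ i ∈ Finset.range N,
          (coord (s + i * δ + π / 2) (suppPt K (s + i * δ + δ)) -
            coord (s + i * δ + π / 2) (suppPt K (s + i * δ)))) / cos δ) := by
        rw [Finset.sum_div, ENNReal.ofReal_sum_of_nonneg]
        exact fun i _ => div_nonneg (sub_nonneg.2 (coord_tangent_suppPt_le K hδ0 hδ _)) hc.le
    _ ≤ _ := by
        gcongr
        exact sum_arc_le K hN hR s

/-- Averaging over the offset `s` turns the Riemann sums into the exact integral, so their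
convergence need not be discussed. -/
lemma integral_sum_supp {N : ℕ} {δ : ℝ} (hN : N * δ = 2 * π) :
    ∫ s in (0 : ℝ)..δ, ∑ i ∈ Finset.range N, supp K (s + i * δ) =
      ∫ θ in (0 : ℝ)..2 * π, supp K θ := by
  have hc := continuous_supp K
  rw [intervalIntegral.integral_finsetSum]
  · have h := intervalIntegral.sum_integral_adjacent_intervals (μ := volume) (f := supp K)
      (a := fun i : ℕ => (i : ℝ) * δ) (n := N) fun k _ => hc.intervalIntegrable _ _
    rw [hN] at h
    simp only [Nat.cast_zero, zero_mul] at h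
    rw [← h]
    refine Finset.sum_congr rfl fun i _ => ?_
    rw [intervalIntegral.integral_comp_add_right]
    congr 1 <;> push_cast <;> ring
  · intro i _
    exact (hc.comp (continuous_id.add continuous_const)).intervalIntegrable _ _

lemma integral_supp :
    ∫ θ in (0 : ℝ)..2 * π, supp K θ = ∫ θ in (0 : ℝ)..π, width K θ := by
  have hc := continuous_supp K
  have hc' : Continuous fun θ => supp K (θ + π) := by fun_prop
  unfold width
  rw [intervalIntegral.integral_add (hc.intervalIntegrable _ _) (hc'.intervalIntegrable _ _),
    intervalIntegral.integral_comp_add_right, zero_add, ← two_mul,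
    intervalIntegral.integral_add_adjacent_intervals (hc.intervalIntegrable _ _)
      (hc.intervalIntegrable _ _)]

/-- The upper half of Cauchy's perimeter formula. -/
lemma hausdorffMeasure_frontier_le (hK : (interior (K : Set Plane)).Nonempty) :
    μH[1] (frontier (K : Set Plane)) ≤ ENNReal.ofReal (∫ θ in (0 : ℝ)..π, width K θ) := by
  obtain ⟨R, hR0, hR⟩ := exists_norm_le K
  rw [← integral_supp]
  set I := ∫ θ in (0 : ℝ)..2 * π, supp K θ with hI
  -- At least five arcs are needed for `δ n < π / 2`.
  set δ : ℕ → ℝ := fun n => 2 * π / (n + 5 : ℕ) with hδdef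
  have hδ0 : ∀ n, 0 < δ n := fun n => by simp only [hδdef]; positivity
  have hδ2 : ∀ n, δ n < π / 2 := fun n => by
    simp only [hδdef]
    rw [div_lt_iff₀ (by positivity)]
    push_cast
    nlinarith [pi_pos, mul_nonneg pi_pos.le (Nat.cast_nonneg (α := ℝ) n)]
  have hN : ∀ n : ℕ, ((n + 5 : ℕ) : ℝ) * δ n = 2 * π := fun n => by
    simp only [hδdef]; field_simp
  have hfin : μH[1] (frontier (K : Set Plane)) ≠ ⊤ :=
    ne_top_of_le_ne_top ENNReal.ofReal_ne_top
      (hausdorffMeasure_frontier_le_sum K hK (hδ0 0) (hδ2 0) (hN 0) hR 0)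
  set L := (μH[1] (frontier (K : Set Plane))).toReal with hL
  have hL0 : 0 ≤ L := ENNReal.toReal_nonneg
  rw [← ENNReal.ofReal_toReal hfin]
  apply ENNReal.ofReal_le_ofReal
  have key : ∀ n, L * cos (δ n) ≤ sinc (δ n) * I + π * R * δ n := by
    intro n
    have hc : 0 < cos (δ n) := cos_pos_of_mem_Ioo ⟨by linarith [pi_pos, hδ0 n], hδ2 n⟩
    set B := ((n + 5 : ℕ) : ℝ) * ((1 - cos (δ n)) * R) with hB
    set F : ℝ → ℝ := fun s => ∑ i ∈ Finset.range (n + 5), supp K (s + i * δ n) with hF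
    have hFc : Continuous F := by
      have := continuous_supp K
      simp only [hF]; fun_prop
    have h1 : ∀ s, L * cos (δ n) ≤ sin (δ n) * F s + B := by
      intro s
      have h := hausdorffMeasure_frontier_le_sum K hK (hδ0 n) (hδ2 n) (hN n) hR s
      rw [← ENNReal.ofReal_toReal hfin, ← hL] at h
      -- `ENNReal.ofReal` truncates negative values, so the real inequality can be read off only
      -- when `L > 0`. For `L = 0` the tangential increments are nonnegative.
      rcases le_or_gt L 0 with h0 | h0
      · have hLz : L = 0 := le_antisymm h0 hL0
        rw [hLz, zero_mul]
        refine le_trans ?_ (sum_arc_le K (hN n) hR s)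
        exact Finset.sum_nonneg fun i _ =>
          sub_nonneg.2 (coord_tangent_suppPt_le K (hδ0 n) (hδ2 n) _)
      · rw [ENNReal.ofReal_le_ofReal_iff', or_iff_left (not_le.2 h0), le_div_iff₀ hc] at h
        exact h
    have h2 : ∫ _ in (0 : ℝ)..δ n, L * cos (δ n) ≤ ∫ s in (0 : ℝ)..δ n, (sin (δ n) * F s + B) :=
      intervalIntegral.integral_mono (hδ0 n).le (by simp)
        ((by fun_prop : Continuous fun s => sin (δ n) * F s + B).intervalIntegrable _ _) h1
    rw [intervalIntegral.integral_const, intervalIntegral.integral_add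
      ((by fun_prop : Continuous fun s => sin (δ n) * F s).intervalIntegrable _ _) (by simp),
      intervalIntegral.integral_const_mul, integral_sum_supp K (hN n),
      intervalIntegral.integral_const, ← hI, smul_eq_mul, smul_eq_mul, sub_zero] at h2
    have h3 : B ≤ π * R * δ n := by
      have h4 := one_sub_sq_div_two_le_cos (x := δ n)
      calc B ≤ ((n + 5 : ℕ) : ℝ) * ((δ n ^ 2 / 2) * R) := by
            rw [hB]; gcongr; linarith
        _ = (((n + 5 : ℕ) : ℝ) * δ n) * δ n * R / 2 := by ring
        _ = _ := by rw [hN]; ring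
    rw [sinc_of_ne_zero (hδ0 n).ne']
    refine le_of_mul_le_mul_left ?_ (hδ0 n)
    calc δ n * (L * cos (δ n)) ≤ sin (δ n) * I + δ n * B := h2
      _ ≤ sin (δ n) * I + δ n * (π * R * δ n) := by
        have := (hδ0 n).le
        gcongr
      _ = _ := by have := (hδ0 n).ne'; field_simp
  have hlim : Filter.Tendsto δ Filter.atTop (nhds 0) := by
    have := (Filter.tendsto_add_atTop_iff_nat 5).2 (tendsto_const_div_atTop_nhds_zero_nat (2 * π))
    exact this
  have hl : Filter.Tendsto (fun n => L * cos (δ n)) Filter.atTop (nhds (L * cos 0)) :=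
    ((continuous_const.mul continuous_cos).tendsto 0).comp hlim
  have hr : Filter.Tendsto (fun n => sinc (δ n) * I + π * R * δ n) Filter.atTop
      (nhds (sinc 0 * I + π * R * 0)) :=
    ((((continuous_sinc.mul continuous_const).add
      (continuous_const.mul continuous_id)).tendsto 0).comp hlim)
  have := le_of_tendsto_of_tendsto' hl hr key
  simpa using this

lemma integral_width_eq (t : ℝ) : ∫ θ in (0 : ℝ)..π, width K θ =
    ∫ ψ in (0 : ℝ)..π / 2, (width K (t + ψ) + width K (t - ψ)) := by
  have hc := continuous_width K
  have hc₁ : Continuous fun ψ => width K (t + ψ) := by fun_prop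
  have hc₂ : Continuous fun ψ => width K (t - ψ) := by fun_prop
  have hper : Function.Periodic (width K) π := width_add_pi K
  have h := hper.intervalIntegral_add_eq 0 (t - π / 2)
  rw [zero_add] at h
  rw [h, intervalIntegral.integral_add (hc₁.intervalIntegrable _ _) (hc₂.intervalIntegrable _ _),
    intervalIntegral.integral_comp_add_left, intervalIntegral.integral_comp_sub_left,
    add_comm (∫ x in t + 0..t + π / 2, width K x), add_zero, sub_zero,
    intervalIntegral.integral_add_adjacent_intervals (hc.intervalIntegrable _ _)
      (hc.intervalIntegrable _ _)]
  congr 1; ring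

end

/-! ### Helly's theorem, the inradius and the minimal width. -/

section

/-- Helly's theorem in the plane, for compact convex sets any three of which meet. -/
lemma nonempty_iInter_of_triples {ι : Type*} [Nonempty ι] {F : ι → Set Plane}
    (hconv : ∀ i, Convex ℝ (F i)) (hcomp : ∀ i, IsCompact (F i))
    (h : ∀ i j k, ∃ q, q ∈ F i ∧ q ∈ F j ∧ q ∈ F k) : (⋂ i, F i).Nonempty := by
  classical
  apply Convex.helly_theorem_compact' hconv hcomp
  intro I hI
  rw [finrank_euclideanSpace_fin] at hI
  obtain ⟨i, j, k, hIs⟩ : ∃ i j k, I ⊆ {i, j, k} := by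
    obtain ⟨i₀⟩ := ‹Nonempty ι›
    interval_cases hc : I.card
    · exact ⟨i₀, i₀, i₀, by simp [Finset.card_eq_zero.1 hc]⟩
    · obtain ⟨i, rfl⟩ := Finset.card_eq_one.1 hc
      exact ⟨i, i, i, by simp⟩
    · obtain ⟨i, j, -, rfl⟩ := Finset.card_eq_two.1 hc
      exact ⟨i, j, j, by simp⟩
    · obtain ⟨i, j, k, -, -, -, rfl⟩ := Finset.card_eq_three.1 hc
      exact ⟨i, j, k, subset_rfl⟩
  obtain ⟨q, h1, h2, h3⟩ := h i j k
  refine ⟨q, mem_iInter₂.2 fun l hl => ?_⟩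
  have := hIs hl
  simp only [Finset.mem_insert, Finset.mem_singleton] at this
  rcases this with rfl | rfl | rfl <;> assumption

variable (K : ConvexBody Plane)

/-- The sets `x / 3 + (2 / 3) K`, for `x` in `K`, meet in threes at centroids, so by Helly they
share a point `c`. Taking for `x` the extreme point opposite to `θ` gives the estimate. -/
lemma exists_coord_add_width_div_three_le :
    ∃ c : Plane, ∀ θ, coord θ c + width K θ / 3 ≤ supp K θ := by
  have hne : Nonempty K := K.nonempty.to_subtype
  let F : K → Set Plane := fun x =>
    (fun w => (1 / 3 : ℝ) • (x : Plane) + w) '' ((2 / 3 : ℝ) • (K : Set Plane))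
  have hmem : ∀ x y z : K, (1 / 3 : ℝ) • ((x : Plane) + y + z) ∈ F x := by
    intro x y z
    refine ⟨(2 / 3 : ℝ) • ((1 / 2 : ℝ) • (y : Plane) + (1 / 2 : ℝ) • (z : Plane)), ?_, ?_⟩
    · exact smul_mem_smul_set
        (K.convex y.2 z.2 (by norm_num) (by norm_num) (by norm_num))
    · module
  obtain ⟨c, hc⟩ := nonempty_iInter_of_triples (F := F)
    (fun x => (K.convex.smul _).translate _)
    (fun x => (K.isCompact.smul _).image (by fun_prop))
    (fun x y z => ⟨(1 / 3 : ℝ) • ((x : Plane) + y + z), hmem x y z,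
      by rw [show (x : Plane) + y + z = y + x + z by abel]; exact hmem y x z,
      by rw [show (x : Plane) + y + z = z + x + y by abel]; exact hmem z x y⟩)
  refine ⟨c, fun θ => ?_⟩
  obtain ⟨_, ⟨k, hk, rfl⟩, hkc⟩ := mem_iInter.1 hc ⟨suppPt K (θ + π), suppPt_mem K _⟩
  have h1 := coord_le_supp θ hk
  have h2 : coord θ c = 1 / 3 * coord θ (suppPt K (θ + π)) + 2 / 3 * coord θ k := by
    rw [← hkc]; simp only [coord_add, coord_smul]
  have h3 : supp K (θ + π) = -coord θ (suppPt K (θ + π)) := coord_add_pi _ _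
  rw [width, h3]; linarith

variable {K} in
lemma lt_inradius {c : Plane} {ρ : ℝ} (hρ : 0 ≤ ρ) (h : ∀ θ, coord θ c + ρ < supp K θ) :
    ρ < inradius K := by
  have hcont : Continuous fun θ => supp K θ - coord θ c :=
    (continuous_supp K).sub (continuous_coord_angle c)
  obtain ⟨σ, hσ, hle⟩ := (isCompact_Icc (a := (0 : ℝ)) (b := 2 * π)).exists_forall_le'
    hcont.continuousOn (a := ρ) fun θ _ => by linarith [h θ]
  refine hσ.trans_le (le_inradius (c := c) (hρ.trans hσ.le) (closedBall_subset fun θ => ?_))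
  have hper : Function.Periodic (fun θ => supp K θ - coord θ c) (2 * π) := fun θ => by
    simp only [supp_add_two_pi, coord_add_two_pi]
  obtain ⟨φ, hφ, he⟩ := hper.exists_mem_Ico₀ two_pi_pos θ
  have := hle φ (Ico_subset_Icc_self hφ)
  linarith

variable {K} in
/-- If a disc in `K` touches the boundary only on one side of a line through its centre, then it
can be enlarged. -/
lemma lt_inradius_of_half {c : Plane} {ρ α : ℝ} (hρ : 0 ≤ ρ)
    (h : ∀ θ, coord θ c + ρ ≤ supp K θ)
    (h' : ∀ θ, 0 ≤ cos (θ - α) → coord θ c + ρ < supp K θ) : ρ < inradius K := by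
  have hcont : Continuous fun θ => supp K θ - coord θ c :=
    (continuous_supp K).sub (continuous_coord_angle c)
  have hcomp : IsCompact (Icc 0 (2 * π) ∩ {θ : ℝ | 0 ≤ cos (θ - α)}) :=
    isCompact_Icc.inter_right (isClosed_le continuous_const (by fun_prop))
  obtain ⟨σ, hσ, hle⟩ := hcomp.exists_forall_le' hcont.continuousOn (a := ρ)
    fun θ hθ => by linarith [h' θ hθ.2]
  have hper : Function.Periodic (fun θ => (supp K θ - coord θ c, cos (θ - α))) (2 * π) :=
    fun θ => by
      simp only [supp_add_two_pi, coord_add_two_pi, add_sub_right_comm θ, cos_add_two_pi]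
  -- Moving the centre by `ε` in direction `α` uses at most half of the slack on the side `cos (θ -
  -- α) ≥ 0` and creates slack on the other.
  set ε := (σ - ρ) / 2 with hε
  have hε0 : 0 < ε := by rw [hε]; linarith
  refine lt_inradius (c := c + !₂[ε * cos α, ε * sin α]) hρ fun θ => ?_
  have hco : coord θ (c + !₂[ε * cos α, ε * sin α]) = coord θ c + ε * cos (θ - α) := by
    rw [coord_add, cos_sub]; simp [coord]; ring
  rw [hco]
  rcases le_or_gt 0 (cos (θ - α)) with h0 | h0
  · obtain ⟨φ, hφ, he⟩ := hper.exists_mem_Ico₀ two_pi_pos θ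
    obtain ⟨he1, he2⟩ := Prod.ext_iff.1 he
    simp only at he1 he2
    have := hle φ ⟨Ico_subset_Icc_self hφ, by rw [mem_ofPred, ← he2]; exact h0⟩
    have h1 : ε * cos (θ - α) ≤ ε * 1 := by gcongr; exact cos_le_one _
    linarith
  · have := mul_neg_of_pos_of_neg hε0 h0
    linarith [h θ]

/-- The width of `K` in some direction is at most three times the inradius. -/
lemma exists_width_le : ∃ θ, width K θ ≤ 3 * inradius K := by
  by_contra! hcon
  obtain ⟨c, hc⟩ := exists_coord_add_width_div_three_le K
  exact lt_irrefl _ (lt_inradius (inradius_nonneg K) (c := c) fun θ => by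
    linarith [hc θ, hcon θ])

variable {K} in
-- The disc of radius `ρ` about the Helly point can touch only the supporting lines at `θ₁` and `θ₁
-- + π`. It cannot touch both, since the width there would be `2ρ < 3ρ`.
lemma lt_inradius_of_width {ρ θ₁ : ℝ} (hρ : 0 < ρ) (h : ∀ θ, 3 * ρ ≤ width K θ)
    (h' : ∀ θ, width K θ ≤ 3 * ρ → sin (θ - θ₁) = 0) : ρ < inradius K := by
  obtain ⟨c, hc⟩ := exists_coord_add_width_div_three_le K
  have hle : ∀ θ, coord θ c + ρ ≤ supp K θ := fun θ => by linarith [hc θ, h θ]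
  have key : ∀ α, (∀ θ, width K θ ≤ 3 * ρ → sin (θ - α) = 0) → coord α c + ρ < supp K α →
      ρ < inradius K := by
    intro α hα hlt
    refine lt_inradius_of_half hρ.le hle (α := α) fun θ hθ => ?_
    rcases lt_or_ge (3 * ρ) (width K θ) with h1 | h1
    · linarith [hc θ]
    have hs := hα θ h1
    have hcos : cos (θ - α) = 1 := by
      have := sin_sq_add_cos_sq (θ - α)
      rw [hs] at this
      nlinarith
    obtain ⟨n, hn⟩ := (cos_eq_one_iff _).1 hcos
    have hper : Function.Periodic (fun θ => supp K θ - coord θ c) (2 * π) := fun θ => by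
      simp only [supp_add_two_pi, coord_add_two_pi]
    have := hper.int_mul n α
    rw [hn, add_sub_cancel] at this
    linarith
  rcases (hle θ₁).lt_or_eq with h1 | h1
  · exact key θ₁ h' h1
  · refine key (θ₁ + π) (fun θ hθ => ?_) ?_
    · rw [← sub_sub, sin_sub_pi, h' θ hθ, neg_zero]
    · have := h θ₁
      rw [width] at this
      rw [coord_add_pi]; linarith

/-- A weak Jung theorem: `33 / 50` lies between the sharp `1 / √3` and the `2 / 3` below which the
application works. If no midpoint of a side serves, all medians are long. This bounds the sides from
below and hence the medians from above, and the centroid serves. -/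
lemma exists_dist_le_of_triangle {D : ℝ} (hD : 0 ≤ D) {x y z : Plane} (hxy : ‖x - y‖ ≤ D)
    (hyz : ‖y - z‖ ≤ D) (hzx : ‖z - x‖ ≤ D) :
    ∃ q, dist q x ≤ 33 / 50 * D ∧ dist q y ≤ 33 / 50 * D ∧ dist q z ≤ 33 / 50 * D := by
  have hsq : ∀ v : Plane, ‖v‖ ^ 2 = v 0 ^ 2 + v 1 ^ 2 := fun v => by
    rw [EuclideanSpace.norm_sq_eq, Fin.sum_univ_two]; simp
  have red : ∀ q w : Plane, ‖q - w‖ ^ 2 ≤ (33 / 50 * D) ^ 2 → dist q w ≤ 33 / 50 * D :=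
    fun q w h => by rw [dist_eq_norm]; exact le_of_sq_le_sq h (by positivity)
  have hmid : ∀ u v : Plane, ‖u - v‖ ≤ D → dist ((1 / 2 : ℝ) • (u + v)) u ≤ 33 / 50 * D ∧
      dist ((1 / 2 : ℝ) • (u + v)) v ≤ 33 / 50 * D := by
    intro u v h
    have h2 := pow_le_pow_left₀ (norm_nonneg _) h 2
    constructor <;> apply red <;> rw [hsq] at h2 ⊢ <;> simp at h2 ⊢ <;> nlinarith
  by_cases h1 : dist ((1 / 2 : ℝ) • (y + z)) x ≤ 33 / 50 * D
  · exact ⟨_, h1, hmid y z hyz⟩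
  by_cases h2 : dist ((1 / 2 : ℝ) • (z + x)) y ≤ 33 / 50 * D
  · exact ⟨_, (hmid z x hzx).2, h2, (hmid z x hzx).1⟩
  by_cases h3 : dist ((1 / 2 : ℝ) • (x + y)) z ≤ 33 / 50 * D
  · exact ⟨_, (hmid x y hxy).1, (hmid x y hxy).2, h3⟩
  have hred := fun q w => not_le.1 ∘ mt (red q w)
  have g1 := hred _ _ h1
  have g2 := hred _ _ h2
  have g3 := hred _ _ h3
  have a1 := pow_le_pow_left₀ (norm_nonneg _) hxy 2
  have a2 := pow_le_pow_left₀ (norm_nonneg _) hyz 2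
  have a3 := pow_le_pow_left₀ (norm_nonneg _) hzx 2
  refine ⟨(1 / 3 : ℝ) • (x + y + z), red _ _ ?_, red _ _ ?_, red _ _ ?_⟩ <;>
  · rw [hsq] at *
    simp only [PiLp.smul_apply, PiLp.add_apply, PiLp.sub_apply, smul_eq_mul] at *
    nlinarith

variable {K} in
/-- A body of constant width has inradius more than a third of its width. -/
lemma lt_three_mul_inradius (hD : 0 < diameter K) (h : ∀ θ, diameter K ≤ width K θ) :
    diameter K < 3 * inradius K := by
  have hne : Nonempty K := K.nonempty.to_subtype
  obtain ⟨q, hq⟩ := nonempty_iInter_of_triples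
    (F := fun x : K => Metric.closedBall (x : Plane) (33 / 50 * diameter K))
    (fun x => convex_closedBall _ _) (fun x => isCompact_closedBall _ _)
    (fun x y z => exists_dist_le_of_triangle hD.le (norm_sub_le_diameter x.2 y.2)
      (norm_sub_le_diameter y.2 z.2) (norm_sub_le_diameter z.2 x.2))
  have hq' : ∀ x ∈ K, ‖x - q‖ ≤ 33 / 50 * diameter K := fun x hx => by
    rw [← dist_eq_norm, dist_comm]; exact mem_iInter.1 hq ⟨x, hx⟩
  -- Constant width turns a circumscribed disc of radius `33 / 50 * D` into a concentric inscribed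
  -- one of radius `17 / 50 * D`, and `17 / 50 > 1 / 3`.
  have hb : 17 / 50 * diameter K ≤ inradius K := by
    refine le_inradius (c := q) (by positivity) (closedBall_subset fun θ => ?_)
    have h1 := (coord_le_norm (θ + π) _).trans (hq' _ (suppPt_mem K (θ + π)))
    have h2 := h θ
    rw [coord_sub, coord_add_pi θ q] at h1
    rw [width, show supp K (θ + π) = coord (θ + π) (suppPt K (θ + π)) from rfl] at h2
    linarith
  linarith

end

/-! ### Kubota's bound, strictness and the theorem. -/

section

/-- Among the points of the disc of radius `D` at height at most `D sin β`, the one at angle `β`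
from the horizontal is extreme in the direction at angle `ψ` from the vertical, if `β + ψ < π / 2`. -/
lemma cos_mul_add_sin_mul_le {D β ψ a b : ℝ} (hD : 0 ≤ D) (hβ : 0 ≤ β) (hψ : 0 ≤ ψ)
    (hβψ : β + ψ < π / 2) (ha : a ≤ D * sin β) (hab : a ^ 2 + b ^ 2 ≤ D ^ 2) :
    cos ψ * a + sin ψ * b ≤ D * sin (β + ψ) := by
  have hcβ : 0 < cos β := cos_pos_of_mem_Ioo ⟨by linarith [pi_pos], by linarith⟩
  have hc : 0 ≤ cos (β + ψ) := cos_nonneg_of_mem_Icc ⟨by linarith [pi_pos], hβψ.le⟩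
  have hs : 0 ≤ sin ψ := sin_nonneg_of_nonneg_of_le_pi hψ (by linarith [pi_pos])
  have h1 : sin β * a + cos β * b ≤ D := by
    apply le_of_sq_le_sq _ hD
    have : (sin β * a + cos β * b) ^ 2 + (cos β * a - sin β * b) ^ 2 = a ^ 2 + b ^ 2 := by
      linear_combination (a ^ 2 + b ^ 2) * sin_sq_add_cos_sq β
    nlinarith [sq_nonneg (cos β * a - sin β * b)]
  refine le_of_mul_le_mul_left ?_ hcβ
  -- The direction at `ψ` is a nonnegative combination of the strip's normal and the radial
  -- direction of the corner, both of which the corner maximises.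
  calc cos β * (cos ψ * a + sin ψ * b)
      = cos (β + ψ) * a + sin ψ * (sin β * a + cos β * b) := by rw [cos_add]; ring
    _ ≤ cos (β + ψ) * (D * sin β) + sin ψ * D := by gcongr
    _ = cos β * (D * sin (β + ψ)) := by
        rw [cos_add, sin_add]
        linear_combination (-D * sin ψ) * sin_sq_add_cos_sq β

/-- The support function of the disc of radius `D` cut by the strip of half-width `D sin β`,
at the angle `ψ` from the normal of the strip. -/
def cutDiscSupp (D β ψ : ℝ) : ℝ := D * sin (min (π / 2) (β + ψ))

lemma continuous_cutDiscSupp (D β : ℝ) : Continuous (cutDiscSupp D β) := by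
  unfold cutDiscSupp; fun_prop

lemma integral_cutDiscSupp {D β : ℝ} (hβ : 0 ≤ β) (hβ' : β ≤ π / 2) :
    ∫ ψ in (0 : ℝ)..π / 2, cutDiscSupp D β ψ = D * cos β + D * β := by
  have hc := continuous_cutDiscSupp D β
  rw [← intervalIntegral.integral_add_adjacent_intervals (b := π / 2 - β)
    (hc.intervalIntegrable _ _) (hc.intervalIntegrable _ _)]
  have h1 : ∫ ψ in (0 : ℝ)..π / 2 - β, cutDiscSupp D β ψ = D * cos β := by
    have : ∫ ψ in (0 : ℝ)..π / 2 - β, cutDiscSupp D β ψ =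
        ∫ ψ in (0 : ℝ)..π / 2 - β, D * sin (β + ψ) := by
      apply intervalIntegral.integral_congr
      intro ψ hψ
      rw [uIcc_of_le (by linarith)] at hψ
      simp only [cutDiscSupp]
      rw [min_eq_right (by linarith [hψ.2])]
    rw [this, intervalIntegral.integral_const_mul,
      intervalIntegral.integral_comp_add_left (fun x => sin x), integral_sin]
    simp
  have h2 : ∫ ψ in π / 2 - β..π / 2, cutDiscSupp D β ψ = D * β := by
    have : ∫ ψ in π / 2 - β..π / 2, cutDiscSupp D β ψ = ∫ ψ in π / 2 - β..π / 2, D := by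
      apply intervalIntegral.integral_congr
      intro ψ hψ
      rw [uIcc_of_le (by linarith)] at hψ
      simp only [cutDiscSupp]
      rw [min_eq_left (by linarith [hψ.1]), sin_pi_div_two, mul_one]
    rw [this, intervalIntegral.integral_const, smul_eq_mul]; ring
  rw [h1, h2]

variable (K : ConvexBody Plane)

lemma diameter_nonneg : 0 ≤ diameter K := Metric.diam_nonneg

variable {K}

lemma width_le_cutDiscSupp {t β ψ : ℝ} (hβ : 0 ≤ β) (hψ : 0 ≤ ψ)
    (ht : width K t ≤ diameter K * sin β) :
    width K (t + ψ) ≤ cutDiscSupp (diameter K) β ψ ∧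
      width K (t - ψ) ≤ cutDiscSupp (diameter K) β ψ := by
  rw [cutDiscSupp]
  rcases lt_or_ge (β + ψ) (π / 2) with h | h
  · rw [min_eq_right h.le]
    have key : ∀ φ, coord t (suppPt K φ - suppPt K (φ + π)) ^ 2 +
        coord (t + π / 2) (suppPt K φ - suppPt K (φ + π)) ^ 2 ≤ diameter K ^ 2 := fun φ => by
      rw [← norm_sq_eq_coord]
      exact pow_le_pow_left₀ (norm_nonneg _)
        (norm_sub_le_diameter (suppPt_mem K _) (suppPt_mem K _)) 2
    have hle : ∀ φ, coord t (suppPt K φ - suppPt K (φ + π)) ≤ diameter K * sin β := fun φ =>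
      (coord_sub_le_width t (suppPt_mem K _) (suppPt_mem K _)).trans ht
    constructor
    · rw [width_eq, coord_angle_add]
      exact cos_mul_add_sin_mul_le (diameter_nonneg K) hβ hψ h (hle _) (key _)
    · rw [width_eq, coord_angle_sub, sub_eq_add_neg, ← mul_neg]
      exact cos_mul_add_sin_mul_le (diameter_nonneg K) hβ hψ h (hle _)
        (by rw [neg_sq]; exact key _)
  · rw [min_eq_left h, sin_pi_div_two, mul_one]
    exact ⟨width_le_diameter K _, width_le_diameter K _⟩

/-- Kubota's bound: the perimeter of a body of given diameter and bounded minimal width. -/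
lemma integral_width_le {t β : ℝ} (hβ : 0 ≤ β) (hβ' : β ≤ π / 2)
    (ht : width K t ≤ diameter K * sin β) :
    ∫ θ in (0 : ℝ)..π, width K θ ≤ 2 * (diameter K * cos β) + 2 * diameter K * β := by
  have hw := continuous_width K
  have hc := continuous_cutDiscSupp (diameter K) β
  rw [integral_width_eq K t]
  calc _ ≤ ∫ ψ in (0 : ℝ)..π / 2, 2 * cutDiscSupp (diameter K) β ψ := by
        apply intervalIntegral.integral_mono_on (by positivity)
          (Continuous.intervalIntegrable (by fun_prop) _ _)
          (Continuous.intervalIntegrable (by fun_prop) _ _)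
        intro ψ hψ
        linarith [width_le_cutDiscSupp hβ hψ.1 ht]
    _ = _ := by
        rw [intervalIntegral.integral_const_mul, integral_cutDiscSupp hβ hβ']; ring

lemma integral_width_lt {t β : ℝ} (hβ : 0 ≤ β) (hβ' : β ≤ π / 2)
    (ht : width K t ≤ diameter K * sin β)
    (hlt : ∃ ψ ∈ Icc 0 (π / 2),
      width K (t + ψ) + width K (t - ψ) < 2 * cutDiscSupp (diameter K) β ψ) :
    ∫ θ in (0 : ℝ)..π, width K θ < 2 * (diameter K * cos β) + 2 * diameter K * β := by
  have hw := continuous_width K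
  have hc := continuous_cutDiscSupp (diameter K) β
  rw [integral_width_eq K t]
  calc _ < ∫ ψ in (0 : ℝ)..π / 2, 2 * cutDiscSupp (diameter K) β ψ := by
        apply intervalIntegral.integral_lt_integral_of_continuousOn_of_le_of_exists_lt
          (by positivity) (Continuous.continuousOn (by fun_prop))
          (Continuous.continuousOn (by fun_prop)) _ hlt
        intro ψ hψ
        linarith [width_le_cutDiscSupp hβ hψ.1.le ht]
    _ = _ := by
        rw [intervalIntegral.integral_const_mul, integral_cutDiscSupp hβ hβ']; ring

/-- This excludes equality in Kubota's bound: widths as large as those of the cut disc would force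
an inradius larger than `r`. -/
lemma exists_width_add_width_lt {t : ℝ} (hr : 0 < inradius K)
    (ht : width K t ≤ 3 * inradius K)
    (hrD : 3 * inradius K ≤ diameter K) :
    ∃ ψ ∈ Icc 0 (π / 2), width K (t + ψ) + width K (t - ψ) <
      2 * cutDiscSupp (diameter K) (arcsin (3 * inradius K / diameter K)) ψ := by
  set D := diameter K with hDdef
  set r := inradius K with hrdef
  set β := arcsin (3 * r / D) with hβdef
  have hD : 0 < D := by linarith
  have hq : 0 < 3 * r / D := by positivity
  have hq1 : 3 * r / D ≤ 1 := (div_le_one hD).2 hrD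
  have hβ : 0 < β := arcsin_pos.2 hq
  have hβ' : β ≤ π / 2 := arcsin_le_pi_div_two _
  have hsβ : D * sin β = 3 * r := by
    rw [hβdef, sin_arcsin (by linarith) hq1]; field_simp
  by_contra! hcon
  -- Here `ψ` is the distance from `θ` to `t` modulo `π`. Each of the two widths is at most
  -- `cutDiscSupp D β ψ`, so a sum that is not smaller than twice this value bounds each of them
  -- from below.
  have key : ∀ θ, ∃ ψ ∈ Icc 0 (π / 2), cutDiscSupp D β ψ ≤ width K θ ∧
      (ψ = 0 → sin (θ - t) = 0) := by
    intro θ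
    have hper : Function.Periodic (fun θ => (width K θ, sin (θ - t) ^ 2)) π := fun θ => by
      simp only [width_add_pi, add_sub_right_comm θ, sin_add_pi, neg_sq]
    obtain ⟨φ, hφ, he⟩ := hper.exists_mem_Ico pi_pos θ (t - π / 2)
    obtain ⟨he1, he2⟩ := Prod.ext_iff.1 he
    simp only at he1 he2
    have hz : φ = t → sin (θ - t) = 0 := fun h => by
      rwa [h, sub_self, sin_zero, zero_pow two_ne_zero, sq_eq_zero_iff] at he2
    rw [he1]
    rcases le_total t φ with h | h
    · have hm : φ - t ∈ Icc 0 (π / 2) := ⟨by linarith, by linarith [hφ.2]⟩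
      refine ⟨φ - t, hm, ?_, fun h => hz (by linarith)⟩
      have h1 := hcon _ hm
      have h2 := (width_le_cutDiscSupp hβ.le hm.1 (ht.trans hsβ.ge)).2
      rw [add_sub_cancel] at h1
      linarith
    · have hm : t - φ ∈ Icc 0 (π / 2) := ⟨by linarith, by linarith [hφ.1]⟩
      refine ⟨t - φ, hm, ?_, fun h => hz (by linarith)⟩
      have h1 := hcon _ hm
      have h2 := (width_le_cutDiscSupp hβ.le hm.1 (ht.trans hsβ.ge)).1
      rw [sub_sub_cancel] at h1
      linarith
  rcases le_or_gt D (3 * r) with hDr | hDr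
  · have hβe : β = π / 2 := arcsin_of_one_le ((one_le_div hD).2 hDr)
    have hmin : ∀ θ, D ≤ width K θ := by
      intro θ
      obtain ⟨ψ, hψ, h1, -⟩ := key θ
      rwa [cutDiscSupp, hβe, min_eq_left (by linarith [hψ.1]), sin_pi_div_two, mul_one] at h1
    linarith [lt_three_mul_inradius hD hmin]
  · have hβlt : β < π / 2 := arcsin_lt_pi_div_two.2 ((div_lt_one hD).2 hDr)
    have hg : ∀ ψ, 0 < ψ → 3 * r < cutDiscSupp D β ψ := fun ψ hψ => by
      rw [← hsβ, cutDiscSupp]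
      gcongr
      exact sin_lt_sin_of_lt_of_le_pi_div_two (by linarith) (min_le_left _ _)
        (lt_min hβlt (by linarith))
    have hg0 : cutDiscSupp D β 0 = 3 * r := by
      rw [cutDiscSupp, add_zero, min_eq_right hβ', hsβ]
    refine lt_irrefl r (lt_inradius_of_width (θ₁ := t) hr (fun θ => ?_) fun θ hθ => ?_)
    · obtain ⟨ψ, hψ, h1, -⟩ := key θ
      rcases hψ.1.eq_or_lt with rfl | h0
      · linarith
      · linarith [hg ψ h0]
    · obtain ⟨ψ, hψ, h1, h2⟩ := key θ
      rcases hψ.1.eq_or_lt with h0 | h0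
      · exact h2 h0.symm
      · linarith [hg ψ h0]

variable (K) in
lemma two_mul_inradius_le : 2 * inradius K ≤ diameter K := by
  have : inradius K ≤ diameter K / 2 := by
    refine Real.sSup_le ?_ (div_nonneg (diameter_nonneg K) two_pos.le)
    rintro ρ ⟨hρ, c, hc⟩
    have h1 := coord_add_le_supp hρ hc 0
    have h2 := coord_add_le_supp hρ hc (0 + π)
    have h3 := width_le_diameter K 0
    rw [coord_add_pi] at h2
    rw [width] at h3
    linarith
  linarith

lemma inradius_eq_zero (hK : ¬(interior (K : Set Plane)).Nonempty) : inradius K = 0 := by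
  refine le_antisymm (Real.sSup_le ?_ le_rfl) (inradius_nonneg K)
  rintro ρ ⟨-, c, hc⟩
  by_contra! h
  exact hK ⟨c, interior_mono hc (Metric.ball_subset_interior_closedBall (Metric.mem_ball_self h))⟩

/-- With `r = 0` some width vanishes, so `K` lies on a line and the coordinate along it is
isometric. -/
lemma perimeter_le_of_interior_eq_empty (hK : ¬(interior (K : Set Plane)).Nonempty) :
    perimeter K ≤ ENNReal.ofReal (2 * diameter K) := by
  rw [perimeter, if_neg hK, ENNReal.ofReal_mul two_pos.le, ENNReal.ofReal_ofNat]
  gcongr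
  obtain ⟨θ, hθ⟩ := exists_width_le K
  rw [inradius_eq_zero hK, mul_zero] at hθ
  have h := hausdorffMeasure_le_of_coord (S := K) (c := 1) (τ := θ + π / 2)
    (a := -supp K (θ + π / 2 + π)) (b := supp K (θ + π / 2)) one_pos
    (fun x hx y hy => ?_) (fun x hx => ⟨?_, coord_le_supp _ hx⟩)
  · refine h.trans (ENNReal.ofReal_le_ofReal ?_)
    rw [div_one, sub_neg_eq_add]
    exact width_le_diameter K _
  · have h0 : coord θ (x - y) = 0 :=
      abs_nonpos_iff.1 ((abs_coord_sub_le_width θ hx hy).trans hθ)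
    rw [one_mul]
    apply le_of_sq_le_sq _ (abs_nonneg _)
    rw [norm_sq_eq_coord θ, h0, sq_abs]; simp
  · have := coord_le_supp (θ + π / 2 + π) hx
    rw [coord_add_pi] at this
    linarith

lemma perimeter_le_integral (hK : (interior (K : Set Plane)).Nonempty) :
    perimeter K ≤ ENNReal.ofReal (∫ θ in (0 : ℝ)..π, width K θ) := by
  rw [perimeter, if_pos hK]
  exact hausdorffMeasure_frontier_le K hK

lemma perimeter_le_pi_mul (hK : (interior (K : Set Plane)).Nonempty) :
    perimeter K ≤ ENNReal.ofReal (π * diameter K) := by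
  refine (perimeter_le_integral hK).trans (ENNReal.ofReal_le_ofReal ?_)
  have hw := continuous_width K
  calc ∫ θ in (0 : ℝ)..π, width K θ ≤ ∫ _ in (0 : ℝ)..π, diameter K :=
        intervalIntegral.integral_mono pi_pos.le (hw.intervalIntegrable _ _) (by simp)
          fun θ => width_le_diameter K θ
    _ = _ := by rw [intervalIntegral.integral_const, smul_eq_mul, sub_zero]

lemma diameter_mul_cos_arcsin {D w : ℝ} (hD : 0 < D) :
    D * cos (arcsin (w / D)) = √(D ^ 2 - w ^ 2) := by
  rw [cos_arcsin]
  nth_rewrite 1 [← sqrt_sq hD.le]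
  rw [← sqrt_mul (sq_nonneg D)]
  congr 1; field_simp

lemma perimeter_le_of_three_mul_inradius_le (hD : 0 < diameter K)
    (hrD : 3 * inradius K ≤ diameter K) :
    perimeter K ≤ ENNReal.ofReal (2 * √(diameter K ^ 2 - 9 * inradius K ^ 2) +
      2 * diameter K * arcsin (3 * inradius K / diameter K)) := by
  have hr := inradius_nonneg K
  by_cases hK : (interior (K : Set Plane)).Nonempty
  · obtain ⟨t, ht⟩ := exists_width_le K
    refine (perimeter_le_integral hK).trans (ENNReal.ofReal_le_ofReal ?_)
    have hq : 0 ≤ 3 * inradius K / diameter K := by positivity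
    have h := integral_width_le (t := t) (arcsin_nonneg.2 hq) (arcsin_le_pi_div_two _) (by
      rw [sin_arcsin (by linarith) ((div_le_one hD).2 hrD)]
      refine ht.trans_eq ?_
      field_simp)
    rwa [diameter_mul_cos_arcsin hD, mul_pow, show (3 : ℝ) ^ 2 = 9 by norm_num] at h
  · convert perimeter_le_of_interior_eq_empty hK using 2
    rw [inradius_eq_zero hK]
    simp [sqrt_sq hD.le]

lemma perimeter_lt_of_three_mul_inradius_le (hr : 0 < inradius K)
    (hrD : 3 * inradius K ≤ diameter K) :
    perimeter K < ENNReal.ofReal (2 * √(diameter K ^ 2 - 9 * inradius K ^ 2) +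
      2 * diameter K * arcsin (3 * inradius K / diameter K)) := by
  have hD : 0 < diameter K := by linarith
  have hK : (interior (K : Set Plane)).Nonempty := by
    by_contra hK
    exact hr.ne' (inradius_eq_zero hK)
  obtain ⟨t, ht⟩ := exists_width_le K
  have hq : 0 < 3 * inradius K / diameter K := by positivity
  have h := integral_width_lt (t := t) (arcsin_nonneg.2 hq.le) (arcsin_le_pi_div_two _) (by
    rw [sin_arcsin (by linarith) ((div_le_one hD).2 hrD)]
    refine ht.trans_eq ?_
    field_simp) (exists_width_add_width_lt hr ht hrD)
  rw [diameter_mul_cos_arcsin hD, mul_pow, show (3 : ℝ) ^ 2 = 9 by norm_num] at h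
  refine (perimeter_le_integral hK).trans_lt ((ENNReal.ofReal_lt_ofReal_iff ?_).2 h)
  have := arcsin_pos.2 hq
  positivity

/-- The arcsine takes its clamped value `π / 2`, so its term alone is `πD`, and the positive square
root gives strictness. -/
lemma perimeter_lt_of_lt_three_mul_inradius (hD : 0 < diameter K)
    (hrD : diameter K < 3 * inradius K) :
    perimeter K < ENNReal.ofReal (√(4 * diameter K ^ 2 - 9 * inradius K ^ 2) +
      2 * diameter K * arcsin (3 * inradius K / diameter K)) := by
  have hK : (interior (K : Set Plane)).Nonempty := by
    by_contra hK
    rw [inradius_eq_zero hK] at hrD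
    linarith
  have hsqrt : 0 < √(4 * diameter K ^ 2 - 9 * inradius K ^ 2) :=
    sqrt_pos.2 (by nlinarith [two_mul_inradius_le K])
  rw [arcsin_of_one_le ((one_le_div hD).2 hrD.le)]
  refine (perimeter_le_pi_mul hK).trans_lt ((ENNReal.ofReal_lt_ofReal_iff ?_).2 ?_)
  · positivity
  · linarith

lemma two_mul_sqrt_le (D r : ℝ) : 2 * √(D ^ 2 - 9 * r ^ 2) ≤ √(4 * D ^ 2 - 9 * r ^ 2) := by
  rw [show (2 : ℝ) = √(2 ^ 2) from (sqrt_sq two_pos.le).symm, ← sqrt_mul (by norm_num)]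
  apply sqrt_le_sqrt
  nlinarith [sq_nonneg r]

end

end PlanarBody

end

theorem mainTheorem11 (K : ConvexBody PlanarBody.Plane)
    (hK : (K : Set PlanarBody.Plane).Nontrivial) (p : ENNReal) (D r : ℝ)
    (hp : p = PlanarBody.perimeter K) (hD : D = PlanarBody.diameter K)
    (hr : r = PlanarBody.inradius K) :
    -- the inequality as displayed, and its strictness for bodies with interior points
    (p ≤ ENNReal.ofReal (√(4 * D ^ 2 - 9 * r ^ 2) + 2 * D * Real.arcsin (3 * r / D))) ∧
    (0 < r →
      p < ENNReal.ofReal (√(4 * D ^ 2 - 9 * r ^ 2) + 2 * D * Real.arcsin (3 * r / D))) ∧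
    -- the stronger inequality, and its strictness for bodies with interior points
    (3 * r ≤ D →
      p ≤ ENNReal.ofReal (2 * √(D ^ 2 - 9 * r ^ 2) + 2 * D * Real.arcsin (3 * r / D))) ∧
    (0 < r → 3 * r ≤ D →
      p < ENNReal.ofReal (2 * √(D ^ 2 - 9 * r ^ 2) + 2 * D * Real.arcsin (3 * r / D))) := by
  subst hp hD hr
  have hD : 0 < PlanarBody.diameter K := by
    obtain ⟨x, hx, y, hy, hxy⟩ := hK
    exact (norm_pos_iff.2 (sub_ne_zero.2 hxy)).trans_le (PlanarBody.norm_sub_le_diameter hx hy)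
  have hmono := ENNReal.ofReal_le_ofReal (add_le_add_left
    (PlanarBody.two_mul_sqrt_le (PlanarBody.diameter K) (PlanarBody.inradius K))
    (2 * PlanarBody.diameter K * Real.arcsin (3 * PlanarBody.inradius K / PlanarBody.diameter K)))
  refine ⟨?_, fun hr => ?_, PlanarBody.perimeter_le_of_three_mul_inradius_le hD,
    PlanarBody.perimeter_lt_of_three_mul_inradius_le⟩
  · rcases le_or_gt (3 * PlanarBody.inradius K) (PlanarBody.diameter K) with h | h
    · exact (PlanarBody.perimeter_le_of_three_mul_inradius_le hD h).trans hmono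
    · exact (PlanarBody.perimeter_lt_of_lt_three_mul_inradius hD h).le
  · rcases le_or_gt (3 * PlanarBody.inradius K) (PlanarBody.diameter K) with h | h
    · exact (PlanarBody.perimeter_lt_of_three_mul_inradius_le hr h).trans_le hmono
    · exact PlanarBody.perimeter_lt_of_lt_three_mul_inradius hD h
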